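/- Let $\lambda>-\tfrac12$, $\lambda\neq 0$. Define the Gegenbauer polynomials by $C_0^\lambda(x)=1$, $C_1^\lambda(x)=2\lambda x$ and $nC_n^\lambda(x)=2(n+\lambda-1)x\,C_{n-1}^\lambda(x)-(n+2\lambda-2)C_{n-2}^\lambda(x)$ for $n\ge 2$, and set $$h_l^\lambda=\frac{2^{1-2\lambda}\pi}{\Gamma(\lambda)^2}\,\frac{\Gamma(l+2\lambda)}{l!\,(l+\lambda)},\qquad \hat u_l^\lambda=\frac1{h_l^\lambda}\int_{-1}^1 u(x)\,C_l^\lambda(x)\,(1-x^2)^{\lambda-1/2}\,dx,\qquad (\pi_n^\lambda u)(x)=\sum_{l=0}^n \hat u_l^\lambda\, C_l^\lambda(x).$$ For every $\delta\ge 1$ and every such $\lambda$ there is a constant $K(\delta,\lambda)>0$, depending only on $\delta$ and $\lambda$, with the following property. Let $M>0$ and let $u$ be a real-valued analytic function on $[-1,1]$ such that $$\max_{|x|\le 1}\Big|\frac{d^k u}{dx^k}(x)\Big|\le M\,\frac{k!}{\delta^k}\qquad\text{for all integers } k\ge 0 .$$ Then for all integers $n\ge 1$, $$\max_{|x|\le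 1}\big|(\pi_n^\lambda u-u)(x)\big|\le K(\delta,\lambda)\,M\,\frac{n^\lambda}{(2\delta)^n}.$$ -/

import Mathlib

open Polynomial

noncomputable section

/-- The Gegenbauer (ultraspherical) polynomials in Szegő's normalization, by the three-term
recurrence `n C_n = 2 (n + lam - 1) x C_{n-1} - (n + 2 lam - 2) C_{n-2}` for `n ≥ 2`, with
`C_0 = 1` and `C_1 = 2 lam x`. -/
def gegenbauer (lam : ℝ) : ℕ → ℝ[X]
  | 0 => 1
  | 1 => C (2 * lam) * X
  | n + 2 =>
      C (((n : ℝ) + 2)⁻¹) *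
        (C (2 * (((n : ℝ) + 2) + lam - 1)) * X * gegenbauer lam (n + 1)
          - C (((n : ℝ) + 2) + 2 * lam - 2) * gegenbauer lam n)

/-- The normalization constant
`h_n = 2 ^ (1 - 2 lam) π Γ(n + 2 lam) / (Γ(lam) ^ 2 n! (n + lam))`. -/
def gegenbauerNorm (lam : ℝ) (n : ℕ) : ℝ :=
  (2 : ℝ) ^ (1 - 2 * lam) * Real.pi / Real.Gamma lam ^ 2 *
    (Real.Gamma ((n : ℝ) + 2 * lam) / ((n.factorial : ℝ) * ((n : ℝ) + lam)))

/-- The `l`-th Gegenbauer coefficient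
`h_l⁻¹ ∫_{-1}^{1} u(x) C_l(x) (1 - x²) ^ (lam - 1/2) dx`. -/
def gegenbauerCoeff (lam : ℝ) (u : ℝ → ℝ) (l : ℕ) : ℝ :=
  1 / gegenbauerNorm lam l *
    ∫ x in (-1 : ℝ)..1, u x * (gegenbauer lam l).eval x * (1 - x ^ 2) ^ (lam - 1 / 2)

/-- The truncated Gegenbauer expansion `π_n u = ∑_{l = 0}^{n} û_l C_l`. -/
def gegenbauerProj (lam : ℝ) (n : ℕ) (u : ℝ → ℝ) (x : ℝ) : ℝ :=
  ∑ l ∈ Finset.range (n + 1), gegenbauerCoeff lam u l * (gegenbauer lam l).eval x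

end

/-! Write w_λ = (1 - x²)^(λ - 1/2). Since (w_{λ+1} C_l^{λ+1})' is a multiple of w_λ C_{l+1}^λ, one
integration by parts trades (u, l+1, λ) for (u', l, λ+1) (`integral_mul_gegenbauer_succ`). Doing
this m ≤ l times and then applying Bessel's inequality bounds the square of the l-th coefficient
integral by h_l times the product over j < m of q_j = (j+1)² / (δ² (l-j)(l+j+2λ)), up to a constant
times M².

Taking m = l gives (2δ)^(-l) times a power of l, because l! / ∏ (l+j+2λ) decays like 4^(-l) up to
powers. That power need not be as small as n^λ. But q_j is large for j near l, so m = l is not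
optimal: stopping ⌊l/D⌋ steps early discards only factors q_j ≥ 4 (`prod_le_quarter_pow_mul`). This
gains an exponential factor that absorbs every polynomial loss, including a crude bound for C_l on
[-1, 1]. Each term is therefore at most K M (ψ/(2δ))^l with ψ < 1
(`exists_abs_gegenbauerCoeff_mul_le`).

The series then converges uniformly, completeness identifies its sum with u
(`eqOn_tsum_gegenbauer`), and the error is a geometric tail; finally ψ^n ≤ K' n^λ. -/

/-! ### Recurrences and differentiation -/

theorem gegenbauer_recurrence (lam : ℝ) (n : ℕ) (x : ℝ) :
    ((n : ℝ) + 2) * (gegenbauer lam (n + 2)).eval x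
      = 2 * ((n : ℝ) + 1 + lam) * x * (gegenbauer lam (n + 1)).eval x
        - ((n : ℝ) + 2 * lam) * (gegenbauer lam n).eval x := by
  have h : ((n : ℝ) + 2) ≠ 0 := by positivity
  rw [gegenbauer]
  simp only [eval_mul, eval_C, eval_sub, eval_X]
  field_simp
  ring

@[simp] theorem gegenbauer_zero_eval (lam x : ℝ) : (gegenbauer lam 0).eval x = 1 := by
  simp [gegenbauer]

@[simp] theorem gegenbauer_one_eval (lam x : ℝ) : (gegenbauer lam 1).eval x = 2 * lam * x := by
  simp [gegenbauer]

/-- Two contiguous relations between the families with parameters `lam` and `lam + 1`. -/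
theorem gegenbauer_contiguous (lam x : ℝ) (n : ℕ) :
    ((n : ℝ) + 1 + 2 * lam) * (gegenbauer lam (n + 1)).eval x
      = 2 * lam * ((gegenbauer (lam + 1) (n + 1)).eval x - x * (gegenbauer (lam + 1) n).eval x) ∧
    ((n : ℝ) + 2) * (gegenbauer lam (n + 2)).eval x
      = 2 * lam * (x * (gegenbauer (lam + 1) (n + 1)).eval x - (gegenbauer (lam + 1) n).eval x) := by
  induction n with
  | zero =>
    have h := gegenbauer_recurrence lam 0 x
    simp at h ⊢
    constructor
    · ring
    · rw [h]; ring
  | succ n ih =>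
    obtain ⟨h2, h3⟩ := ih
    have hA := gegenbauer_recurrence lam (n + 1) x
    have hB := gegenbauer_recurrence (lam + 1) n x
    have hn : ((n : ℝ) + 2) ≠ 0 := by positivity
    push_cast at *
    -- The next first relation needs only the current second one and the recurrence at `lam + 1`.
    have h2' : ((n : ℝ) + 2 + 2 * lam) * (gegenbauer lam (n + 2)).eval x
      = 2 * lam * ((gegenbauer (lam + 1) (n + 2)).eval x
        - x * (gegenbauer (lam + 1) (n + 1)).eval x) := by
      apply mul_left_cancel₀ hn
      linear_combination ((n : ℝ) + 2 + 2 * lam) * h3 - 2 * lam * hB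
    have e1 : n + 1 + 1 = n + 2 := rfl
    have e2 : n + 1 + 2 = n + 3 := rfl
    rw [e1, e2] at *
    constructor
    · linear_combination h2'
    · linear_combination hA + x * h2' + x * h3 - h2

/-- Differentiating the recurrence leaves one undifferentiated term, which the contiguous relations
rewrite in the family `lam + 1`. -/
theorem gegenbauer_derivative_eval (lam x : ℝ) (n : ℕ) :
    (derivative (gegenbauer lam (n + 1))).eval x = 2 * lam * (gegenbauer (lam + 1) n).eval x := by
  induction n using Nat.strong_induction_on with
  | _ n ih =>
    match n, ih with
    | 0, _ => simp [gegenbauer]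
    | 1, _ =>
      simp [gegenbauer, derivative_mul]
      ring
    | n + 2, ih =>
      have h1 := ih (n + 1) (by omega)
      have h0 := ih n (by omega)
      have hn : ((n : ℝ) + 3) ≠ 0 := by positivity
      have hB := gegenbauer_recurrence (lam + 1) n x
      have hrec : ((n : ℝ) + 3) * (derivative (gegenbauer lam (n + 3))).eval x
          = 2 * ((n : ℝ) + 2 + lam) * ((gegenbauer lam (n + 2)).eval x
            + x * (derivative (gegenbauer lam (n + 2))).eval x)
          - ((n : ℝ) + 1 + 2 * lam) * (derivative (gegenbauer lam (n + 1))).eval x := by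
        rw [show n + 3 = (n + 1) + 2 from rfl, gegenbauer]
        have : ((n : ℝ) + 1 + 2) ≠ 0 := by positivity
        simp [derivative_mul]
        field_simp
        ring
      have h3 := (gegenbauer_contiguous lam x n).2
      have h2 := (gegenbauer_contiguous lam x (n + 1)).1
      push_cast at h2
      have e1 : n + 1 + 1 = n + 2 := rfl
      rw [e1] at h1 h2
      apply mul_left_cancel₀ hn
      rw [show n + 2 + 1 = n + 3 from rfl, hrec, h1, h0]
      linear_combination h2 + h3 - 2 * lam * hB

/-- This is the derivative of (1 - x²)^(λ+1/2) C_n^{λ+1}, divided by (1 - x²)^(λ-1/2): the identity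
behind the integration by parts. -/
theorem one_sub_sq_mul_gegenbauer_derivative (lam : ℝ) (hlam : lam ≠ 0) (x : ℝ) (n : ℕ) :
    (1 - x ^ 2) * (derivative (gegenbauer (lam + 1) n)).eval x
      - (2 * lam + 1) * x * (gegenbauer (lam + 1) n).eval x
      = -(((n : ℝ) + 1) * ((n : ℝ) + 1 + 2 * lam) / (2 * lam)) *
          (gegenbauer lam (n + 1)).eval x := by
  rcases n with _ | n
  · simp [gegenbauer]
    field_simp
    ring
  · rw [gegenbauer_derivative_eval]
    have h3 := (gegenbauer_contiguous lam x n).2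
    have hl : (2 * lam) ≠ 0 := by simpa using hlam
    have hn : ((n : ℝ) + 2) ≠ 0 := by positivity
    rw [show n + 1 + 1 = n + 2 from rfl]
    have key : (1 - x ^ 2) * (2 * (lam + 1) * (gegenbauer (lam + 1 + 1) n).eval x)
        = ((n : ℝ) + 2 + 2 * lam) * ((gegenbauer (lam + 1) n).eval x)
          - ((n : ℝ) + 1) * x * (gegenbauer (lam + 1) (n + 1)).eval x := by
      rcases n with _ | n
      · simp
        ring
      · have a := (gegenbauer_contiguous (lam + 1) x n).1
        have b := (gegenbauer_contiguous (lam + 1) x n).2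
        push_cast
        rw [show n + 1 + 1 = n + 2 from rfl]
        linear_combination -a + x * b
    rw [key, eq_div_of_mul_eq hn ((mul_comm _ _).trans h3)]
    push_cast
    field_simp
    ring

/-! ### Beta integrals and normalization constants -/

open MeasureTheory Set in
theorem intervalIntegrable_rpow_mul_one_sub_rpow {a b : ℝ} (ha : 0 < a) (hb : 0 < b) :
    IntervalIntegrable (fun x : ℝ => x ^ (a - 1) * (1 - x) ^ (b - 1)) volume 0 1 := by
  have h := Complex.betaIntegral_convergent (u := a) (v := b) (by simpa) (by simpa)
  rw [intervalIntegrable_iff_integrableOn_Ioc_of_le zero_le_one] at h ⊢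
  refine IntegrableOn.congr_fun (Integrable.re h) (fun x hx => ?_) measurableSet_Ioc
  have h1 : (0 : ℝ) ≤ 1 - x := by linarith [hx.2]
  simp only [RCLike.re_to_complex]
  norm_cast
  rw [← Complex.ofReal_cpow hx.1.le, ← Complex.ofReal_cpow h1, ← Complex.ofReal_mul,
    Complex.ofReal_re]

open MeasureTheory Set in
theorem integral_rpow_mul_one_sub_rpow {a b : ℝ} (ha : 0 < a) (hb : 0 < b) :
    ∫ x in (0 : ℝ)..1, x ^ (a - 1) * (1 - x) ^ (b - 1)
      = Real.Gamma a * Real.Gamma b / Real.Gamma (a + b) := by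
  have h := Complex.betaIntegral_convergent (u := a) (v := b) (by simpa) (by simpa)
  rw [intervalIntegrable_iff_integrableOn_Ioc_of_le zero_le_one] at h
  have hb' := ProbabilityTheory.beta_eq_betaIntegralReal a b ha hb
  rw [ProbabilityTheory.beta] at hb'
  rw [hb', Complex.betaIntegral, intervalIntegral.integral_of_le zero_le_one,
    intervalIntegral.integral_of_le zero_le_one, ← RCLike.re_to_complex, ← integral_re h]
  refine setIntegral_congr_fun measurableSet_Ioc fun x hx => ?_
  have h1 : (0 : ℝ) ≤ 1 - x := by linarith [hx.2]
  simp only [RCLike.re_to_complex]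
  norm_cast
  rw [← Complex.ofReal_cpow hx.1.le, ← Complex.ofReal_cpow h1, ← Complex.ofReal_mul,
    Complex.ofReal_re]

theorem one_sub_sq_rpow_eq {s x : ℝ} (hx : x ∈ Set.Icc (-1 : ℝ) 1) :
    (1 - x ^ 2) ^ s = 4 ^ s * ((x / 2 + 1 / 2) ^ s * (1 - (x / 2 + 1 / 2)) ^ s) := by
  obtain ⟨h1, h2⟩ := hx
  rw [← Real.mul_rpow (by linarith) (by linarith),
    ← Real.mul_rpow (by norm_num) (mul_nonneg (by linarith) (by linarith))]
  congr 1
  ring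

open MeasureTheory in
theorem intervalIntegrable_one_sub_sq_rpow {s : ℝ} (hs : -1 < s) :
    IntervalIntegrable (fun x : ℝ => (1 - x ^ 2) ^ s) volume (-1) 1 := by
  have h := intervalIntegrable_rpow_mul_one_sub_rpow (a := s + 1) (b := s + 1)
    (by linarith) (by linarith)
  have h2 := ((h.comp_mul_right (c := 1 / 2)).comp_add_right (1 : ℝ)).const_mul ((4 : ℝ) ^ s)
  norm_num at h2
  refine h2.congr ?_
  intro x hx
  rw [Set.uIoc_of_le (by norm_num)] at hx
  have := one_sub_sq_rpow_eq (s := s) (Set.Ioc_subset_Icc_self hx)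
  simp only
  rw [this]
  ring_nf

theorem integral_one_sub_sq_rpow {s : ℝ} (hs : -1 < s) :
    ∫ x in (-1 : ℝ)..1, (1 - x ^ 2) ^ s
      = 2 * 4 ^ s * (Real.Gamma (s + 1) ^ 2 / Real.Gamma (2 * s + 2)) := by
  have h := integral_rpow_mul_one_sub_rpow (a := s + 1) (b := s + 1)
    (by linarith) (by linarith)
  have h2 := intervalIntegral.integral_comp_div_add (a := -1) (b := 1)
    (fun t : ℝ => t ^ s * (1 - t) ^ s) (c := 2) two_ne_zero (1 / 2)
  simp only [add_sub_cancel_right] at h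
  norm_num at h2
  have h3 : ∫ x in (-1 : ℝ)..1, (1 - x ^ 2) ^ s
      = ∫ x in (-1 : ℝ)..1, 4 ^ s * ((x / 2 + 1 / 2) ^ s * (1 - (x / 2 + 1 / 2)) ^ s) := by
    apply intervalIntegral.integral_congr
    intro x hx
    rw [Set.uIcc_of_le (by norm_num)] at hx
    exact one_sub_sq_rpow_eq hx
  rw [h3, intervalIntegral.integral_const_mul, h2, h]
  ring_nf

/-- The Beta integral, brought to the stated form by Legendre's duplication formula. -/
theorem integral_weight_eq_gegenbauerNorm_zero {lam : ℝ} (hlam : -(1 / 2) < lam) (hlam0 : lam ≠ 0) :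
    ∫ x in (-1 : ℝ)..1, (1 - x ^ 2) ^ (lam - 1 / 2) = gegenbauerNorm lam 0 := by
  rw [integral_one_sub_sq_rpow (by linarith), gegenbauerNorm]
  have hd := Real.Gamma_mul_Gamma_add_half lam
  have h1 : Real.Gamma (2 * (lam - 1 / 2) + 2) = 2 * lam * Real.Gamma (2 * lam) := by
    rw [← Real.Gamma_add_one (by simpa using hlam0)]
    congr 1
    ring
  have hne : ∀ m : ℕ, lam ≠ -m := by
    rintro (_ | m) h
    · simp at h; exact hlam0 h
    · push_cast at h
      have : (0 : ℝ) ≤ m := m.cast_nonneg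
      linarith
  have hg : Real.Gamma lam ≠ 0 := Real.Gamma_ne_zero hne
  have hg2 : Real.Gamma (2 * lam) ≠ 0 := by
    apply Real.Gamma_ne_zero
    rintro (_ | m) h
    · simp at h; exact hlam0 h
    · push_cast at h
      have : (0 : ℝ) ≤ m := m.cast_nonneg
      linarith
  have hG : Real.Gamma (lam + 1 / 2)
      = Real.Gamma (2 * lam) * 2 ^ (1 - 2 * lam) * √Real.pi / Real.Gamma lam := by
    rw [eq_div_iff hg, mul_comm, hd]
  have h4 : (4 : ℝ) ^ (lam - 1 / 2) * 2 ^ (1 - 2 * lam) = 1 := by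
    rw [show (4 : ℝ) = 2 ^ (2 : ℝ) by norm_num, ← Real.rpow_mul (by norm_num),
      ← Real.rpow_add (by norm_num)]
    ring_nf
    simp
  rw [show lam - 1 / 2 + 1 = lam + 1 / 2 by ring, h1, hG]
  simp only [div_pow, mul_pow, Real.sq_sqrt Real.pi_pos.le, Nat.factorial_zero, Nat.cast_zero,
    Nat.cast_one, zero_add, one_mul]
  generalize (4 : ℝ) ^ (lam - 1 / 2) = p at h4 ⊢
  generalize (2 : ℝ) ^ (1 - 2 * lam) = q at h4 ⊢
  field_simp
  linear_combination q * h4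

theorem gegenbauerNorm_succ {lam : ℝ} (hlam : -(1 / 2) < lam) (hlam0 : lam ≠ 0) (n : ℕ) :
    gegenbauerNorm lam (n + 1) = (2 * lam) ^ 2 / (((n : ℝ) + 1) * ((n : ℝ) + 1 + 2 * lam)) *
      gegenbauerNorm (lam + 1) n := by
  have hn : (0 : ℝ) ≤ n := n.cast_nonneg
  have h1 : (n : ℝ) + 1 + 2 * lam ≠ 0 := by linarith
  have h2 : (n : ℝ) + 1 + lam ≠ 0 := by linarith
  have h3 : (n : ℝ) + 1 ≠ 0 := by linarith
  have h4 : (n.factorial : ℝ) ≠ 0 := by positivity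
  have hg : Real.Gamma lam ≠ 0 := by
    apply Real.Gamma_ne_zero
    rintro (_ | m) h
    · simp at h; exact hlam0 h
    · push_cast at h
      have : (0 : ℝ) ≤ m := m.cast_nonneg
      linarith
  rw [gegenbauerNorm, gegenbauerNorm, Real.Gamma_add_one hlam0,
    show ((n : ℝ) + 2 * (lam + 1)) = ((n : ℝ) + 1 + 2 * lam) + 1 by ring, Real.Gamma_add_one h1,
    show (1 - 2 * (lam + 1)) = (1 - 2 * lam) - 2 by ring, Real.rpow_sub (by norm_num) _ 2,
    Nat.factorial_succ]
  generalize (2 : ℝ) ^ (1 - 2 * lam) = q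
  push_cast
  rw [show ((n : ℝ) + (lam + 1)) = (n : ℝ) + 1 + lam by ring]
  field_simp
  norm_num
  ring

/-- For negative λ the closed form at degree 0 is a quotient of two negative numbers, so positivity
is read off from the integral of the weight. -/
theorem gegenbauerNorm_pos {lam : ℝ} (hlam : -(1 / 2) < lam) (hlam0 : lam ≠ 0) (n : ℕ) :
    0 < gegenbauerNorm lam n := by
  induction n generalizing lam with
  | zero =>
    rw [← integral_weight_eq_gegenbauerNorm_zero hlam hlam0]
    apply intervalIntegral.intervalIntegral_pos_of_pos_on
      (intervalIntegrable_one_sub_sq_rpow (by linarith)) _ (by norm_num)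
    intro x hx
    exact Real.rpow_pos_of_pos (by nlinarith [hx.1, hx.2]) _
  | succ n ih =>
    rw [gegenbauerNorm_succ hlam hlam0]
    have hn : (0 : ℝ) ≤ n := n.cast_nonneg
    have h1 : 0 < (n : ℝ) + 1 + 2 * lam := by linarith
    exact mul_pos (by positivity) (ih (by linarith) (by linarith))

/-! ### Integration by parts and orthogonality -/

open MeasureTheory in
theorem intervalIntegrable_mul_weight {lam : ℝ} (hlam : -(1 / 2) < lam) {g : ℝ → ℝ}
    (hg : ContinuousOn g (Set.Icc (-1) 1)) :
    IntervalIntegrable (fun x => g x * (1 - x ^ 2) ^ (lam - 1 / 2)) volume (-1) 1 := by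
  apply (intervalIntegrable_one_sub_sq_rpow (by linarith)).continuousOn_mul
  rwa [Set.uIcc_of_le (by norm_num)]

theorem weight_nonneg {s x : ℝ} (hx : x ∈ Set.Icc (-1 : ℝ) 1) : 0 ≤ (1 - x ^ 2) ^ s :=
  Real.rpow_nonneg (by nlinarith [hx.1, hx.2]) _

/-- Integrate the derivative of f C_l^{λ+1} (1 - x²)^(λ+1/2); the boundary values vanish because λ +
1/2 > 0. Differentiability is asked only inside, where the weight is smooth. -/
theorem integral_mul_gegenbauer_succ {lam : ℝ} (hlam : -(1 / 2) < lam) (hlam0 : lam ≠ 0)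
    {f f' : ℝ → ℝ} (hf : ContinuousOn f (Set.Icc (-1) 1)) (hf' : ContinuousOn f' (Set.Icc (-1) 1))
    (hff' : ∀ x ∈ Set.Ioo (-1 : ℝ) 1, HasDerivAt f (f' x) x) (l : ℕ) :
    ∫ x in (-1 : ℝ)..1, f x * (gegenbauer lam (l + 1)).eval x * (1 - x ^ 2) ^ (lam - 1 / 2)
      = 2 * lam / (((l : ℝ) + 1) * ((l : ℝ) + 1 + 2 * lam)) *
        ∫ x in (-1 : ℝ)..1, f' x * (gegenbauer (lam + 1) l).eval x *
          (1 - x ^ 2) ^ (lam + 1 - 1 / 2) := by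
  have hl : (0 : ℝ) ≤ l := l.cast_nonneg
  have h1 : (l : ℝ) + 1 + 2 * lam ≠ 0 := by linarith
  have h2 : (l : ℝ) + 1 ≠ 0 := by linarith
  set κ := ((l : ℝ) + 1) * ((l : ℝ) + 1 + 2 * lam) / (2 * lam) with hκ
  have i1 := intervalIntegrable_mul_weight (lam := lam + 1) (by linarith)
    (g := fun x => f' x * (gegenbauer (lam + 1) l).eval x)
    (hf'.mul (gegenbauer (lam + 1) l).continuousOn)
  have i2 := intervalIntegrable_mul_weight hlam
    (g := fun x => f x * (gegenbauer lam (l + 1)).eval x)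
    (hf.mul (gegenbauer lam (l + 1)).continuousOn)
  have key := intervalIntegral.integral_eq_sub_of_hasDerivAt_of_le (a := -1) (b := 1)
    (f := fun x => f x * (gegenbauer (lam + 1) l).eval x * (1 - x ^ 2) ^ (lam + 1 / 2))
    (f' := fun x => f' x * (gegenbauer (lam + 1) l).eval x * (1 - x ^ 2) ^ (lam + 1 - 1 / 2)
      - κ * (f x * (gegenbauer lam (l + 1)).eval x * (1 - x ^ 2) ^ (lam - 1 / 2)))
    (by norm_num) ?_ ?_ (i1.sub (i2.const_mul κ))
  · rw [intervalIntegral.integral_sub i1 (i2.const_mul κ), intervalIntegral.integral_const_mul] at key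
    have hz : lam + 1 / 2 ≠ 0 := by linarith
    norm_num [Real.zero_rpow hz] at key
    rw [sub_eq_zero.1 key, hκ]
    generalize ∫ x in (-1 : ℝ)..1, f x * (gegenbauer lam (l + 1)).eval x *
      (1 - x ^ 2) ^ (lam - 1 / 2) = J
    field_simp
  · refine (hf.mul (gegenbauer (lam + 1) l).continuousOn).mul ?_
    exact ContinuousOn.rpow_const (by fun_prop) fun x _ => Or.inr (by linarith)
  · intro x hx
    have hpos : 0 < 1 - x ^ 2 := by nlinarith [hx.1, hx.2]
    have hw : HasDerivAt (fun x : ℝ => (1 - x ^ 2) ^ (lam + 1 / 2))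
        (-(2 * x) * (lam + 1 / 2) * (1 - x ^ 2) ^ (lam - 1 / 2)) x := by
      have h0 : HasDerivAt (fun x : ℝ => 1 - x ^ 2) (-(2 * x)) x := by
        simpa using (hasDerivAt_pow 2 x).const_sub 1
      have := h0.rpow_const (p := lam + 1 / 2) (Or.inl hpos.ne')
      rwa [show lam + 1 / 2 - 1 = lam - 1 / 2 by ring] at this
    have := ((hff' x hx).mul ((gegenbauer (lam + 1) l).hasDerivAt x)).mul hw
    refine this.congr_deriv ?_
    have hE := one_sub_sq_mul_gegenbauer_derivative lam hlam0 x l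
    have e1 : (1 - x ^ 2) ^ (lam + 1 / 2) = (1 - x ^ 2) * (1 - x ^ 2) ^ (lam - 1 / 2) := by
      rw [← Real.rpow_one_add' hpos.le (by linarith)]
      congr 1
      ring
    rw [show lam + 1 - 1 / 2 = lam + 1 / 2 by ring, e1]
    rw [← hκ] at hE
    simp only [Pi.mul_apply]
    linear_combination (f x * (1 - x ^ 2) ^ (lam - 1 / 2)) * hE

theorem integral_gegenbauer_mul_self {lam : ℝ} (hlam : -(1 / 2) < lam) (hlam0 : lam ≠ 0) (n : ℕ) :
    ∫ x in (-1 : ℝ)..1, (gegenbauer lam n).eval x * (gegenbauer lam n).eval x *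
      (1 - x ^ 2) ^ (lam - 1 / 2) = gegenbauerNorm lam n := by
  induction n generalizing lam with
  | zero => simpa using integral_weight_eq_gegenbauerNorm_zero hlam hlam0
  | succ n ih =>
    rw [integral_mul_gegenbauer_succ hlam hlam0 (gegenbauer lam (n + 1)).continuousOn
      (derivative (gegenbauer lam (n + 1))).continuousOn
      (fun x _ => (gegenbauer lam (n + 1)).hasDerivAt x), gegenbauerNorm_succ hlam hlam0,
      ← ih (lam := lam + 1) (by linarith) (by linarith)]
    simp_rw [gegenbauer_derivative_eval, mul_assoc]
    rw [intervalIntegral.integral_const_mul, intervalIntegral.integral_const_mul]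
    ring

/-- Each integration by parts lowers both degrees, until the smaller-degree factor is a constant and
its derivative vanishes. -/
theorem integral_gegenbauer_mul_of_lt {lam : ℝ} (hlam : -(1 / 2) < lam) (hlam0 : lam ≠ 0)
    {k n : ℕ} (hkn : k < n) :
    ∫ x in (-1 : ℝ)..1, (gegenbauer lam k).eval x * (gegenbauer lam n).eval x *
      (1 - x ^ 2) ^ (lam - 1 / 2) = 0 := by
  induction n generalizing lam k with
  | zero => omega
  | succ n ih =>
    rw [integral_mul_gegenbauer_succ hlam hlam0 (gegenbauer lam k).continuousOn
      (derivative (gegenbauer lam k)).continuousOn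
      (fun x _ => (gegenbauer lam k).hasDerivAt x)]
    rcases k with _ | k
    · simp [gegenbauer]
    · have := ih (lam := lam + 1) (by linarith) (by linarith) (k := k) (by omega)
      simp_rw [gegenbauer_derivative_eval, mul_assoc] at this ⊢
      rw [intervalIntegral.integral_const_mul, intervalIntegral.integral_const_mul, this]
      simp

theorem integral_gegenbauer_mul_of_ne {lam : ℝ} (hlam : -(1 / 2) < lam) (hlam0 : lam ≠ 0)
    {k n : ℕ} (hkn : k ≠ n) :
    ∫ x in (-1 : ℝ)..1, (gegenbauer lam k).eval x * (gegenbauer lam n).eval x *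
      (1 - x ^ 2) ^ (lam - 1 / 2) = 0 := by
  rcases hkn.lt_or_gt with h | h
  · exact integral_gegenbauer_mul_of_lt hlam hlam0 h
  · rw [← integral_gegenbauer_mul_of_lt hlam hlam0 h]
    simp_rw [mul_comm (eval _ (gegenbauer lam k))]

/-! ### Coefficient bounds from derivatives -/

/-- Bessel's inequality for a single coefficient, with a uniform bound on the function. -/
theorem sq_integral_mul_gegenbauer_le {lam : ℝ} (hlam : -(1 / 2) < lam) (hlam0 : lam ≠ 0)
    {f : ℝ → ℝ} (hf : ContinuousOn f (Set.Icc (-1) 1)) {B : ℝ}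
    (hB : ∀ x ∈ Set.Icc (-1 : ℝ) 1, |f x| ≤ B) (l : ℕ) :
    (∫ x in (-1 : ℝ)..1, f x * (gegenbauer lam l).eval x * (1 - x ^ 2) ^ (lam - 1 / 2)) ^ 2
      ≤ gegenbauerNorm lam l * (B ^ 2 * gegenbauerNorm lam 0) := by
  set P := gegenbauer lam l
  have hP : ContinuousOn (fun x => P.eval x) (Set.Icc (-1) 1) := P.continuousOn
  set I := ∫ x in (-1 : ℝ)..1, f x * P.eval x * (1 - x ^ 2) ^ (lam - 1 / 2) with hI
  have hh := gegenbauerNorm_pos hlam hlam0 l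
  have hW := integral_weight_eq_gegenbauerNorm_zero hlam hlam0
  set h := gegenbauerNorm lam l
  -- The coefficient of f along P; the bound is nonnegativity of the weighted integral of (f - tP)².
  set t := I / h
  have i1 := intervalIntegrable_mul_weight hlam (g := fun x => f x * f x) (hf.mul hf)
  have i2 := intervalIntegrable_mul_weight hlam (g := fun x => f x * P.eval x) (hf.mul hP)
  have i3 := intervalIntegrable_mul_weight hlam (g := fun x => P.eval x * P.eval x) (hP.mul hP)
  have hle : ∫ x in (-1 : ℝ)..1, f x * f x * (1 - x ^ 2) ^ (lam - 1 / 2)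
      ≤ B ^ 2 * gegenbauerNorm lam 0 := by
    rw [← hW, ← intervalIntegral.integral_const_mul]
    apply intervalIntegral.integral_mono_on (by norm_num) i1
      ((intervalIntegrable_one_sub_sq_rpow (by linarith)).const_mul _)
    intro x hx
    apply mul_le_mul_of_nonneg_right _ (weight_nonneg hx)
    rw [← sq, ← sq_abs]
    exact pow_le_pow_left₀ (abs_nonneg _) (hB x hx) 2
  have hpos : 0 ≤ ∫ x in (-1 : ℝ)..1, (f x * f x * (1 - x ^ 2) ^ (lam - 1 / 2)
      - (2 * t) * (f x * P.eval x * (1 - x ^ 2) ^ (lam - 1 / 2)))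
      + t ^ 2 * (P.eval x * P.eval x * (1 - x ^ 2) ^ (lam - 1 / 2)) := by
    apply intervalIntegral.integral_nonneg (by norm_num)
    intro x hx
    have := mul_nonneg (sq_nonneg (f x - t * P.eval x)) (weight_nonneg (s := lam - 1 / 2) hx)
    linarith
  rw [intervalIntegral.integral_add (i1.sub (i2.const_mul _)) (i3.const_mul _),
    intervalIntegral.integral_sub i1 (i2.const_mul _), intervalIntegral.integral_const_mul,
    intervalIntegral.integral_const_mul, integral_gegenbauer_mul_self hlam hlam0, ← hI] at hpos
  have hI2 : I = t * h := by simp only [t]; field_simp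
  have : t ^ 2 * h ≤ B ^ 2 * gegenbauerNorm lam 0 := by
    rw [hI2] at hpos
    linarith
  calc I ^ 2 = h * (t ^ 2 * h) := by rw [hI2]; ring
    _ ≤ _ := mul_le_mul_of_nonneg_left this hh.le

theorem gegenbauerNorm_add_one_zero_le {lam : ℝ} (hlam : -(1 / 2) < lam) (hlam0 : lam ≠ 0) :
    gegenbauerNorm (lam + 1) 0 ≤ gegenbauerNorm lam 0 := by
  rw [← integral_weight_eq_gegenbauerNorm_zero hlam hlam0,
    ← integral_weight_eq_gegenbauerNorm_zero (by linarith) (by linarith)]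
  apply intervalIntegral.integral_mono_on_of_le_Ioo (by norm_num)
    (intervalIntegrable_one_sub_sq_rpow (by linarith))
    (intervalIntegrable_one_sub_sq_rpow (by linarith))
  intro x hx
  exact Real.rpow_le_rpow_of_exponent_ge (by nlinarith [hx.1, hx.2]) (by nlinarith [sq_nonneg x])
    (by linarith)

/-- Each integration by parts contributes a squared factor, half of which is absorbed by
`gegenbauerNorm_succ`; the rest is one factor of the product. The mass of the weight only decreases
as λ grows by 1. -/
theorem sq_integral_mul_gegenbauer_le_of_iteratedDerivWithin {lam : ℝ} (hlam : -(1 / 2) < lam)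
    (hlam0 : lam ≠ 0) {f : ℝ → ℝ} (hf : ContDiffOn ℝ ⊤ f (Set.Icc (-1) 1)) {B : ℝ} {m l : ℕ}
    (hml : m ≤ l)
    (hB : ∀ x ∈ Set.Icc (-1 : ℝ) 1, |iteratedDerivWithin m f (Set.Icc (-1) 1) x| ≤ B) :
    (∫ x in (-1 : ℝ)..1, f x * (gegenbauer lam l).eval x * (1 - x ^ 2) ^ (lam - 1 / 2)) ^ 2
      ≤ gegenbauerNorm lam l * (B ^ 2 * gegenbauerNorm lam 0) /
        ∏ j ∈ Finset.range m, (((l : ℝ) - j) * ((l : ℝ) + j + 2 * lam)) := by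
  induction m generalizing lam l f with
  | zero =>
    simpa using sq_integral_mul_gegenbauer_le hlam hlam0 hf.continuousOn (by simpa using hB) l
  | succ m ih =>
    obtain ⟨l, rfl⟩ : ∃ k, l = k + 1 := ⟨l - 1, by omega⟩
    have hud : UniqueDiffOn ℝ (Set.Icc (-1 : ℝ) 1) := uniqueDiffOn_Icc (by norm_num)
    have hf' : ContDiffOn ℝ ⊤ (derivWithin f (Set.Icc (-1) 1)) (Set.Icc (-1) 1) :=
      hf.derivWithin hud (by simp)
    have hl : (0 : ℝ) ≤ l := l.cast_nonneg
    have h1 : 0 < (l : ℝ) + 1 + 2 * lam := by linarith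
    have hder : ∀ x ∈ Set.Ioo (-1 : ℝ) 1,
        HasDerivAt f (derivWithin f (Set.Icc (-1) 1) x) x := fun x hx =>
      ((hf.differentiableOn (by simp) x (Set.Ioo_subset_Icc_self hx)).hasDerivWithinAt).hasDerivAt
        (Icc_mem_nhds hx.1 hx.2)
    have hih := ih (lam := lam + 1) (by linarith) (by linarith) hf' (l := l) (by omega)
      (fun x hx => by
        have := hB x hx
        rwa [iteratedDerivWithin_succ'] at this)
    rw [integral_mul_gegenbauer_succ hlam hlam0 hf.continuousOn hf'.continuousOn hder,
      gegenbauerNorm_succ hlam hlam0, Finset.prod_range_succ']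
    have hprod : ∏ j ∈ Finset.range m, (((l + 1 : ℕ) : ℝ) - ((j + 1 : ℕ) : ℝ)) *
          (((l + 1 : ℕ) : ℝ) + ((j + 1 : ℕ) : ℝ) + 2 * lam)
        = ∏ j ∈ Finset.range m, (((l : ℝ) - j) * ((l : ℝ) + j + 2 * (lam + 1))) :=
      Finset.prod_congr rfl fun j _ => by push_cast; ring
    rw [hprod]
    have hppos : 0 < ∏ j ∈ Finset.range m, (((l : ℝ) - j) * ((l : ℝ) + j + 2 * (lam + 1))) := by
      apply Finset.prod_pos
      intro j hj
      have hjl : j < l := by have := Finset.mem_range.1 hj; omega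
      have hjl' : (j : ℝ) < l := by exact_mod_cast hjl
      have hj0 : (0 : ℝ) ≤ j := j.cast_nonneg
      exact mul_pos (by linarith) (by linarith)
    have hW := gegenbauerNorm_add_one_zero_le hlam hlam0
    have hN := gegenbauerNorm_pos (lam := lam + 1) (by linarith) (by linarith) l
    generalize (∏ j ∈ Finset.range m, (((l : ℝ) - j) * ((l : ℝ) + j + 2 * (lam + 1)))) = Q at *
    rw [mul_pow]
    calc (2 * lam / (((l : ℝ) + 1) * ((l : ℝ) + 1 + 2 * lam))) ^ 2 * _
        ≤ (2 * lam / (((l : ℝ) + 1) * ((l : ℝ) + 1 + 2 * lam))) ^ 2 *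
          (gegenbauerNorm (lam + 1) l * (B ^ 2 * gegenbauerNorm lam 0) / Q) := by
          refine mul_le_mul_of_nonneg_left (hih.trans ?_) (sq_nonneg _)
          gcongr
      _ = _ := by
          push_cast
          have h2 := hppos.ne'
          have h3 := h1.ne'
          rw [add_zero, sub_zero]
          field_simp

/-! ### Generating function and a pointwise bound -/

/-- The binomial coefficients `(lam)_k / k!` of `(1 - t) ^ (-lam)`. -/
noncomputable def risingCoeff (lam : ℝ) (k : ℕ) : ℝ :=
  ∏ j ∈ Finset.range k, ((lam + j) / ((j : ℝ) + 1))

theorem risingCoeff_succ (lam : ℝ) (k : ℕ) :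
    risingCoeff lam (k + 1) * ((k : ℝ) + 1) = (lam + k) * risingCoeff lam k := by
  rw [risingCoeff, Finset.prod_range_succ, ← risingCoeff]
  field_simp

/-- By Bernoulli each factor is at most (1 + 1/(k+1))^N, and these telescope. -/
theorem abs_risingCoeff_le {lam : ℝ} {N : ℕ} (hN : |lam| ≤ N) (k : ℕ) :
    |risingCoeff lam k| ≤ ((k : ℝ) + 1) ^ N := by
  induction k with
  | zero => simp [risingCoeff]
  | succ k ih =>
    have hk : (0 : ℝ) < (k : ℝ) + 1 := by positivity
    rw [risingCoeff, Finset.prod_range_succ, ← risingCoeff, abs_mul, abs_div, abs_of_pos hk]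
    have h1 : |lam + k| / ((k : ℝ) + 1) ≤ 1 + N * (1 / ((k : ℝ) + 1)) := by
      rw [div_le_iff₀ hk]
      have := abs_add_le lam k
      rw [abs_of_nonneg (k.cast_nonneg : (0 : ℝ) ≤ k)] at this
      field_simp
      linarith
    have h2 := one_add_mul_le_pow (a := 1 / ((k : ℝ) + 1))
      (by have : 0 ≤ 1 / ((k : ℝ) + 1) := by positivity
          linarith) N
    calc |risingCoeff lam k| * (|lam + k| / ((k : ℝ) + 1))
        ≤ ((k : ℝ) + 1) ^ N * (1 + 1 / ((k : ℝ) + 1)) ^ N := by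
          gcongr
          exact h1.trans h2
      _ = (((k + 1 : ℕ) : ℝ) + 1) ^ N := by
          rw [← mul_pow]
          congr 1
          push_cast
          field_simp

open PowerSeries in
/-- The binomial series `(1 - z t) ^ (-lam)`. -/
noncomputable def binomialSeriesNeg (lam : ℝ) (z : ℂ) : ℂ⟦X⟧ :=
  PowerSeries.mk fun k => (risingCoeff lam k : ℂ) * z ^ k

open PowerSeries in
theorem one_sub_mul_derivative_binomialSeriesNeg (lam : ℝ) (z : ℂ) :
    d⁄dX ℂ (binomialSeriesNeg lam z) - PowerSeries.C z * (d⁄dX ℂ (binomialSeriesNeg lam z) * PowerSeries.X)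
      = PowerSeries.C (lam * z) * binomialSeriesNeg lam z := by
  ext n
  have h : ∀ k, ((risingCoeff lam (k + 1) : ℝ) : ℂ) * ((k : ℂ) + 1)
      = (lam + k) * (risingCoeff lam k : ℂ) := fun k => by
    exact_mod_cast congrArg (Complex.ofReal) (risingCoeff_succ lam k)
  rcases n with _ | n
  · have h0 := h 0
    simp only [binomialSeriesNeg, map_sub, PowerSeries.coeff_C_mul, PowerSeries.coeff_zero_mul_X,
      PowerSeries.coeff_derivative, PowerSeries.coeff_mk]
    push_cast at h0 ⊢
    linear_combination z * h0
  · have h0 := h (n + 1)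
    push_cast at h0
    simp only [binomialSeriesNeg, map_sub, PowerSeries.coeff_C_mul, PowerSeries.coeff_succ_mul_X,
      PowerSeries.coeff_derivative, PowerSeries.coeff_mk]
    push_cast
    linear_combination z ^ (n + 2) * h0

open PowerSeries in
-- The product G is (1 - 2xt + t²)^(-λ). The equations of its factors combine to (1 - 2xt + t²) G' =
-- 2λ(x - t) G, whose coefficients satisfy the Gegenbauer recurrence.
theorem coeff_binomialSeriesNeg_mul (lam x : ℝ) {z w : ℂ} (hzw : z * w = 1)
    (hadd : z + w = 2 * x) (n : ℕ) :
    PowerSeries.coeff n (binomialSeriesNeg lam z * binomialSeriesNeg lam w)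
      = ((gegenbauer lam n).eval x : ℝ) := by
  set F := binomialSeriesNeg lam z with hF
  set H := binomialSeriesNeg lam w with hH
  set G := F * H with hG
  have h1 := one_sub_mul_derivative_binomialSeriesNeg lam z
  have h2 := one_sub_mul_derivative_binomialSeriesNeg lam w
  rw [← hF] at h1
  rw [← hH] at h2
  have hzw' : PowerSeries.C z * PowerSeries.C w = 1 := by rw [← map_mul, hzw, map_one]
  have hadd' : PowerSeries.C z + PowerSeries.C w = PowerSeries.C (2 * x : ℂ) := by
    rw [← map_add, hadd]
  have hD : d⁄dX ℂ G = F * d⁄dX ℂ H + H * d⁄dX ℂ F := by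
    rw [hG, Derivation.leibniz]; simp
  have hode : d⁄dX ℂ G - PowerSeries.C (2 * x : ℂ) * (d⁄dX ℂ G * PowerSeries.X)
      + d⁄dX ℂ G * PowerSeries.X * PowerSeries.X
      = PowerSeries.C (lam * (2 * x) : ℂ) * G - PowerSeries.C (2 * lam : ℂ) * (G * PowerSeries.X) := by
    rw [map_mul] at h1 h2
    rw [map_mul _ (lam : ℂ) (2 * x), ← hadd', hD, map_mul, map_ofNat]
    rw [hG]
    linear_combination (1 - PowerSeries.C w * PowerSeries.X) * H * h1
      + (1 - PowerSeries.C z * PowerSeries.X) * F * h2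
      - (F * d⁄dX ℂ H + H * d⁄dX ℂ F) * PowerSeries.X ^ 2 * hzw'
      - PowerSeries.C (lam : ℂ) * PowerSeries.X * F * H * 2 * hzw'
  have c0 : PowerSeries.coeff 0 G = 1 := by
    simp [hG, hF, hH, binomialSeriesNeg, risingCoeff, PowerSeries.coeff_mul]
  have c1 : PowerSeries.coeff 1 G = 2 * lam * x := by
    have := congrArg (PowerSeries.coeff 0) hode
    simp only [map_sub, map_add, PowerSeries.coeff_C_mul, PowerSeries.coeff_zero_mul_X,
      PowerSeries.coeff_derivative, c0] at this
    norm_num at this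
    rw [this]; ring
  have cr : ∀ k : ℕ, ((k : ℂ) + 2) * PowerSeries.coeff (k + 2) G
      = 2 * ((k : ℂ) + 1 + lam) * x * PowerSeries.coeff (k + 1) G
        - ((k : ℂ) + 2 * lam) * PowerSeries.coeff k G := by
    intro k
    have := congrArg (PowerSeries.coeff (k + 1)) hode
    rcases k with _ | k
    · simp only [map_sub, map_add, PowerSeries.coeff_C_mul, PowerSeries.coeff_succ_mul_X,
        PowerSeries.coeff_zero_mul_X, PowerSeries.coeff_derivative] at this
      push_cast at this ⊢
      linear_combination this
    · simp only [map_sub, map_add, PowerSeries.coeff_C_mul, PowerSeries.coeff_succ_mul_X,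
        PowerSeries.coeff_derivative] at this
      push_cast at this ⊢
      linear_combination this
  induction n using Nat.strong_induction_on with
  | _ n ih =>
    match n, ih with
    | 0, _ => rw [c0]; simp
    | 1, _ => rw [c1]; simp
    | k + 2, ih =>
      have hk : ((k : ℂ) + 2) ≠ 0 := by exact_mod_cast (by omega : k + 2 ≠ 0)
      apply mul_left_cancel₀ hk
      rw [cr k, ih (k + 1) (by omega), ih k (by omega)]
      exact_mod_cast (congrArg Complex.ofReal (gegenbauer_recurrence lam k x)).symm

/-- With x the real part of a unit complex z, C_n is a Cauchy product of n + 1 terms, each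
polynomially bounded. Any polynomial growth suffices here. -/
theorem abs_gegenbauer_eval_le {lam : ℝ} {N : ℕ} (hN : |lam| ≤ N) (n : ℕ) {x : ℝ}
    (hx : x ∈ Set.Icc (-1 : ℝ) 1) :
    |(gegenbauer lam n).eval x| ≤ ((n : ℝ) + 1) ^ (2 * N + 1) := by
  have hs : 0 ≤ 1 - x ^ 2 := by nlinarith [hx.1, hx.2]
  set z : ℂ := ⟨x, √(1 - x ^ 2)⟩ with hz
  have hmul : z * (starRingEnd ℂ) z = 1 := by
    rw [Complex.mul_conj, Complex.normSq_mk, ← sq, ← sq, Real.sq_sqrt hs]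
    simp
  have hadd : z + (starRingEnd ℂ) z = 2 * x := by
    rw [Complex.add_conj]
    simp [hz]
  have hnz : ‖z‖ = 1 := by
    have h := congrArg norm hmul
    rw [norm_mul, RCLike.norm_conj, norm_one, ← sq] at h
    exact (pow_eq_one_iff_of_nonneg (norm_nonneg _) two_ne_zero).1 h
  have h := coeff_binomialSeriesNeg_mul lam x hmul hadd n
  rw [← Real.norm_eq_abs, ← Complex.norm_real, ← h, PowerSeries.coeff_mul]
  calc ‖∑ p ∈ Finset.HasAntidiagonal.antidiagonal n, PowerSeries.coeff p.1 (binomialSeriesNeg lam z) *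
          PowerSeries.coeff p.2 (binomialSeriesNeg lam ((starRingEnd ℂ) z))‖
      ≤ ∑ p ∈ Finset.HasAntidiagonal.antidiagonal n, ((n : ℝ) + 1) ^ N * ((n : ℝ) + 1) ^ N := by
        refine norm_sum_le_of_le _ fun p hp => ?_
        have hp' := Finset.HasAntidiagonal.mem_antidiagonal.1 hp
        simp only [binomialSeriesNeg, PowerSeries.coeff_mk, norm_mul, norm_pow, RCLike.norm_conj,
          hnz, one_pow, mul_one, Complex.norm_real, Real.norm_eq_abs]
        have e1 : (p.1 : ℝ) ≤ n := by exact_mod_cast (by omega)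
        have e2 : (p.2 : ℝ) ≤ n := by exact_mod_cast (by omega)
        refine mul_le_mul ((abs_risingCoeff_le hN _).trans ?_)
          ((abs_risingCoeff_le hN _).trans ?_) (abs_nonneg _) (by positivity) <;> gcongr
    _ = ((n : ℝ) + 1) ^ (2 * N + 1) := by
        rw [Finset.sum_const, Finset.Nat.card_antidiagonal, nsmul_eq_mul]
        push_cast
        ring

/-! ### Exponential rate of the decay factor -/

open Filter Topology in
theorem exists_le_mul_pow_of_tendsto_ratio {Z : ℕ → ℝ} {a c : ℝ} (hc : 0 < c) (hac : a < c)
    (hZ : ∀ n, 1 ≤ n → 0 < Z n)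
    (h : Tendsto (fun n => Z (n + 1) / Z n) atTop (𝓝 a)) :
    ∃ C, 0 < C ∧ ∀ n, 1 ≤ n → Z n ≤ C * c ^ n := by
  have hs : Summable fun n => Z n / c ^ n := by
    refine summable_of_ratio_test_tendsto_lt_one (l := a / c) ((div_lt_one hc).2 hac) ?_ ?_
    · filter_upwards [eventually_ge_atTop 1] with n hn
      exact (div_pos (hZ n hn) (pow_pos hc n)).ne'
    · refine (h.div_const c).congr' ?_
      filter_upwards [eventually_ge_atTop 1] with n hn
      rw [Real.norm_of_nonneg (div_pos (hZ _ (by omega)) (pow_pos hc _)).le,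
        Real.norm_of_nonneg (div_pos (hZ n hn) (pow_pos hc n)).le]
      have := (hZ n hn).ne'
      rw [pow_succ]
      field_simp
  obtain ⟨C, hC⟩ := hs.tendsto_atTop_zero.bddAbove_range
  refine ⟨max C 1, by positivity, fun n _ => ?_⟩
  have := hC ⟨n, rfl⟩
  rw [div_le_iff₀ (pow_pos hc n)] at this
  exact this.trans (by gcongr; exact le_max_left _ _)

open Filter Topology in
theorem tendsto_natCast_add_div_add (a b : ℝ) :
    Tendsto (fun n : ℕ => ((n : ℝ) + a) / ((n : ℝ) + b)) atTop (𝓝 1) := by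
  simpa [add_comm] using
    tendsto_add_mul_div_add_mul_atTop_nhds a b 1 (one_ne_zero : (1 : ℝ) ≠ 0)

theorem gegenbauerNorm_add_one {lam : ℝ} (hlam : -(1 / 2) < lam) (n : ℕ) (hn : 1 ≤ n) :
    gegenbauerNorm lam (n + 1) = gegenbauerNorm lam n *
      (((n : ℝ) + 2 * lam) * ((n : ℝ) + lam) / (((n : ℝ) + 1) * ((n : ℝ) + 1 + lam))) := by
  have hn' : (1 : ℝ) ≤ n := by exact_mod_cast hn
  have h1 : (n : ℝ) + 2 * lam ≠ 0 := by linarith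
  have h2 : (n : ℝ) + lam ≠ 0 := by linarith
  have h3 : (n : ℝ) + 1 + lam ≠ 0 := by linarith
  have h4 : (n.factorial : ℝ) ≠ 0 := by positivity
  rw [gegenbauerNorm, gegenbauerNorm, Nat.factorial_succ]
  push_cast
  rw [show (n : ℝ) + 1 + 2 * lam = ((n : ℝ) + 2 * lam) + 1 by ring, Real.Gamma_add_one h1]
  field_simp

theorem prod_range_succ_shift (f : ℕ → ℝ) (n : ℕ) :
    (∏ j ∈ Finset.range (n + 1), f (n + 1 + j)) * f n
      = (∏ j ∈ Finset.range n, f (n + j)) * (f (2 * n) * f (2 * n + 1)) := by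
  have h1 := Finset.prod_range_succ' (fun j => f (n + j)) (n + 1)
  have h2 := Finset.prod_range_succ (fun j => f (n + j)) (n + 1)
  rw [h1, Finset.prod_range_succ (fun j => f (n + j)) n] at h2
  simp only [add_zero] at h2
  rw [show n + n = 2 * n by ring, show n + (n + 1) = 2 * n + 1 by ring] at h2
  rw [← mul_assoc, ← h2]
  congr 1
  exact Finset.prod_congr rfl fun j _ => by congr 1; ring

/-- The factor that governs the decay of the terms of a Gegenbauer series when all available
derivatives are used. -/
noncomputable def gegenbauerDecay (lam : ℝ) (N l : ℕ) : ℝ :=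
  1 / gegenbauerNorm lam l * ((l.factorial : ℝ) / ∏ j ∈ Finset.range l, ((l : ℝ) + j + 2 * lam)) *
    ((l : ℝ) + 1) ^ N

theorem prod_natCast_add_pos {lam : ℝ} (hlam : -(1 / 2) < lam) {l m : ℕ} (hl : 1 ≤ l) :
    0 < ∏ j ∈ Finset.range m, ((l : ℝ) + j + 2 * lam) := by
  refine Finset.prod_pos fun j _ => ?_
  have hl' : (1 : ℝ) ≤ l := by exact_mod_cast hl
  have hj : (0 : ℝ) ≤ j := j.cast_nonneg
  linarith

theorem gegenbauerDecay_pos {lam : ℝ} (hlam : -(1 / 2) < lam) (hlam0 : lam ≠ 0) (N l : ℕ)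
    (hl : 1 ≤ l) : 0 < gegenbauerDecay lam N l := by
  have := prod_natCast_add_pos hlam hl (m := l)
  have := gegenbauerNorm_pos hlam hlam0 l
  unfold gegenbauerDecay
  positivity

-- The norms and the power of l + 1 have ratio tending to 1; the limit 1/4 comes from (l+1)(l+2λ) /
-- ((2l+2λ)(2l+1+2λ)).
open Filter Topology in
theorem tendsto_gegenbauerDecay_ratio {lam : ℝ} (hlam : -(1 / 2) < lam) (hlam0 : lam ≠ 0) (N : ℕ) :
    Tendsto (fun l => gegenbauerDecay lam N (l + 1) / gegenbauerDecay lam N l) atTop (𝓝 (1 / 4)) := by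
  have t1 := tendsto_natCast_add_div_add 1 lam
  have t2 := tendsto_natCast_add_div_add (1 + lam) (1 / 2 + lam)
  have t3 := tendsto_natCast_add_div_add 2 1
  have t := (((t1.pow 2).mul t2).mul (t3.pow N)).const_mul (1 / 4 : ℝ)
  rw [one_pow, one_pow, one_mul, one_mul, mul_one] at t
  refine t.congr' ?_
  filter_upwards [eventually_ge_atTop 1] with l hl
  have hl' : (1 : ℝ) ≤ l := by exact_mod_cast hl
  have hp := (prod_natCast_add_pos hlam hl (m := l)).ne'
  have hp' := (prod_natCast_add_pos hlam (l := l + 1) (by omega) (m := l + 1)).ne'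
  have hs := prod_range_succ_shift (fun i => (i : ℝ) + 2 * lam) l
  have e1 : ∏ j ∈ Finset.range (l + 1), (((l + 1 + j : ℕ) : ℝ) + 2 * lam)
      = ∏ j ∈ Finset.range (l + 1), (((l + 1 : ℕ) : ℝ) + j + 2 * lam) :=
    Finset.prod_congr rfl fun j _ => by push_cast; ring
  have e2 : ∏ j ∈ Finset.range l, (((l + j : ℕ) : ℝ) + 2 * lam)
      = ∏ j ∈ Finset.range l, ((l : ℝ) + j + 2 * lam) :=
    Finset.prod_congr rfl fun j _ => by push_cast; ring
  rw [e1, e2] at hs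
  have hh := (gegenbauerNorm_pos hlam hlam0 l).ne'
  rw [gegenbauerDecay, gegenbauerDecay, gegenbauerNorm_add_one hlam l hl, Nat.factorial_succ]
  generalize (∏ j ∈ Finset.range (l + 1), (((l + 1 : ℕ) : ℝ) + j + 2 * lam)) = P' at *
  generalize (∏ j ∈ Finset.range l, ((l : ℝ) + j + 2 * lam)) = P at *
  generalize gegenbauerNorm lam l = h at *
  have h1 : (l : ℝ) + 2 * lam ≠ 0 := by linarith
  have h2 : (l : ℝ) + lam ≠ 0 := by linarith
  have h3 : (l : ℝ) + 1 + lam ≠ 0 := by linarith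
  have h4 : (l.factorial : ℝ) ≠ 0 := by positivity
  have h5 : 2 * (l : ℝ) + 1 + 2 * lam ≠ 0 := by linarith
  have h6 : (l : ℝ) + (1 / 2 + lam) ≠ 0 := by linarith
  have hP' : P' = P * ((2 * l + 2 * lam) * (2 * l + 1 + 2 * lam)) / (l + 2 * lam) := by
    rw [eq_div_iff h1, hs]
    push_cast
    ring
  rw [hP', div_pow ((l : ℝ) + 2)]
  push_cast
  rw [show (l : ℝ) + 1 + 1 = l + 2 by ring, show (l : ℝ) + (1 / 2 + lam) = (2 * l + 1 + 2 * lam) / 2 by ring,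
    show (2 : ℝ) * l + 2 * lam = 2 * (l + lam) by ring, show (l : ℝ) + (1 + lam) = l + 1 + lam by ring]
  have h7 : (l : ℝ) + lam * 2 ≠ 0 := by rwa [mul_comm lam]
  field_simp
  norm_num

/-! ### Stopping early: geometric bound for the terms -/

theorem prod_le_quarter_pow_mul {lam δ : ℝ} (hlam : -(1 / 2) < lam) (hδ : 1 ≤ δ) {D l : ℕ}
    (hD : 32 * δ ^ 2 * (1 + |lam|) ≤ D) (hl : 1 ≤ l) :
    (∏ j ∈ Finset.range (l - l / D), (((j : ℝ) + 1) ^ 2 / (δ ^ 2 * (((l : ℝ) - j) * ((l : ℝ) + j + 2 * lam)))))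
      ≤ (1 / 4) ^ (l / D) *
        ∏ j ∈ Finset.range l, (((j : ℝ) + 1) ^ 2 / (δ ^ 2 * (((l : ℝ) - j) * ((l : ℝ) + j + 2 * lam)))) := by
  have hl' : (1 : ℝ) ≤ l := by exact_mod_cast hl
  have habs := abs_nonneg lam
  have hδ2 : 1 ≤ δ ^ 2 := one_le_pow₀ hδ
  have hD32 : (32 : ℝ) ≤ D := by nlinarith
  have hs : ((l / D : ℕ) : ℝ) ≤ l / D := Nat.cast_div_le
  have hsl : l / D ≤ l := Nat.div_le_self _ _
  generalize l / D = s at *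
  set q : ℕ → ℝ := fun j => ((j : ℝ) + 1) ^ 2 / (δ ^ 2 * (((l : ℝ) - j) * ((l : ℝ) + j + 2 * lam)))
  have hq : ∀ j, j < l → 0 < δ ^ 2 * (((l : ℝ) - j) * ((l : ℝ) + j + 2 * lam)) := by
    intro j hj
    have hj' : (j : ℝ) < l := by exact_mod_cast hj
    have hj0 : (0 : ℝ) ≤ j := j.cast_nonneg
    exact mul_pos (by positivity) (mul_pos (by linarith) (by linarith))
  have hpos : 0 ≤ ∏ j ∈ Finset.range (l - s), q j :=
    Finset.prod_nonneg fun j hj => by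
      have := hq j (by have := Finset.mem_range.1 hj; omega)
      positivity
  have hI : (4 : ℝ) ^ s ≤ ∏ j ∈ Finset.Ico (l - s) l, q j := by
    have hcard : (Finset.Ico (l - s) l).card = s := by rw [Nat.card_Ico]; omega
    conv_lhs => rw [← hcard, ← Finset.prod_const]
    refine Finset.prod_le_prod (fun _ _ => by norm_num) fun j hj => ?_
    obtain ⟨hj1, hj2⟩ := Finset.mem_Ico.1 hj
    have hj1' : (l : ℝ) ≤ j + s := by exact_mod_cast (by omega)
    have hj2' : (j : ℝ) < l := by exact_mod_cast hj2
    have hj0 : (0 : ℝ) ≤ j := j.cast_nonneg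
    rw [le_div_iff₀ (hq j hj2)]
    have a1 : (l : ℝ) - j ≤ l / D := by linarith
    have a2 : (l : ℝ) + j + 2 * lam ≤ 2 * l * (1 + |lam|) := by
      nlinarith [le_abs_self lam]
    have a3 : (l : ℝ) / D ≤ l / 2 := by gcongr; linarith
    have a4 : (l : ℝ) / 2 ≤ j + 1 := by linarith
    -- For the omitted j one has l - j ≤ l/D and j + 1 ≥ l/2, so q_j ≥ 4 as soon as D ≥ 32 δ² (1 +
    -- |λ|).
    calc 4 * (δ ^ 2 * (((l : ℝ) - j) * ((l : ℝ) + j + 2 * lam)))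
        ≤ 4 * (δ ^ 2 * ((l / D) * (2 * l * (1 + |lam|)))) := by
          have : 0 ≤ (l : ℝ) + j + 2 * lam := by linarith
          gcongr
      _ = (32 * δ ^ 2 * (1 + |lam|)) / D * (l / 2) ^ 2 := by ring
      _ ≤ 1 * (l / 2) ^ 2 := by
          gcongr
          exact (div_le_one (by linarith)).2 hD
      _ ≤ ((j : ℝ) + 1) ^ 2 := by
          rw [one_mul]
          gcongr
  rw [← Finset.prod_range_mul_prod_Ico q (Nat.sub_le l (s))]
  have h4 : (1 / 4 : ℝ) ^ s * 4 ^ s = 1 := by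
    rw [← mul_pow]; norm_num
  calc ∏ j ∈ Finset.range (l - s), q j
      = (1 / 4) ^ s * ((∏ j ∈ Finset.range (l - s), q j) * 4 ^ s) := by
        linear_combination (-(∏ j ∈ Finset.range (l - s), q j)) * h4
    _ ≤ (1 / 4) ^ s * ((∏ j ∈ Finset.range (l - s), q j) *
          ∏ j ∈ Finset.Ico (l - s) l, q j) := by gcongr

theorem prod_range_ratio_eq (lam δ : ℝ) (l m : ℕ) :
    (∏ j ∈ Finset.range m, (((j : ℝ) + 1) ^ 2 / (δ ^ 2 * (((l : ℝ) - j) * ((l : ℝ) + j + 2 * lam)))))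
      = ((m.factorial : ℝ) / δ ^ m) ^ 2 /
        ∏ j ∈ Finset.range m, (((l : ℝ) - j) * ((l : ℝ) + j + 2 * lam)) := by
  rw [Finset.prod_div_distrib, Finset.prod_mul_distrib, Finset.prod_pow, Finset.prod_const,
    Finset.card_range]
  have : ∏ j ∈ Finset.range m, ((j : ℝ) + 1) = (m.factorial : ℝ) := by
    rw [← Finset.prod_range_add_one_eq_factorial]
    push_cast
    rfl
  rw [this, div_pow, div_div, ← pow_mul, ← pow_mul, mul_comm 2 m]

theorem prod_range_natCast_sub (l : ℕ) :
    ∏ j ∈ Finset.range l, ((l : ℝ) - j) = (l.factorial : ℝ) := by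
  rw [← Finset.prod_range_reflect, ← Finset.prod_range_add_one_eq_factorial]
  push_cast
  refine Finset.prod_congr rfl fun j hj => ?_
  have := Finset.mem_range.1 hj
  rw [show l - 1 - j = l - (j + 1) by omega, Nat.cast_sub (by omega)]
  push_cast
  ring

theorem exists_abs_gegenbauerCoeff_mul_le {δ lam : ℝ} (hδ : 1 ≤ δ) (hlam : -(1 / 2) < lam)
    (hlam0 : lam ≠ 0) :
    ∃ K ψ : ℝ, 0 < K ∧ 0 < ψ ∧ ψ < 1 ∧ ∀ M : ℝ, 0 < M → ∀ u : ℝ → ℝ,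
      ContDiffOn ℝ ⊤ u (Set.Icc (-1) 1) →
      (∀ k : ℕ, ∀ x ∈ Set.Icc (-1 : ℝ) 1,
          |iteratedDerivWithin k u (Set.Icc (-1) 1) x| ≤ M * (k.factorial : ℝ) / δ ^ k) →
      ∀ l : ℕ, 1 ≤ l → ∀ x ∈ Set.Icc (-1 : ℝ) 1,
        |gegenbauerCoeff lam u l * (gegenbauer lam l).eval x| ≤ K * M * (ψ / (2 * δ)) ^ l := by
  have hδ0 : 0 < δ := by linarith
  obtain ⟨N, hN⟩ := exists_nat_ge |lam|
  obtain ⟨D, hD⟩ := exists_nat_ge (32 * δ ^ 2 * (1 + |lam|))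
  have hDpos : 0 < D := by
    have h : 0 < 32 * δ ^ 2 * (1 + |lam|) := by positivity
    exact_mod_cast h.trans_le hD
  -- The early stop gains about ψ^(4l) in the square. Half of this pays for taking the rate 1/(4ψ²)
  -- > 1/4 in the decay factor; the remaining ψ^(2l) is kept.
  set ψ : ℝ := (1 / 4) ^ (1 / (4 * D : ℝ)) with hψ
  have hψ0 : 0 < ψ := by positivity
  have hψ1 : ψ < 1 := Real.rpow_lt_one (by norm_num) (by norm_num) (by positivity)
  have hψD : ψ ^ (4 * D) = 1 / 4 := by
    rw [hψ, ← Real.rpow_natCast, ← Real.rpow_mul (by norm_num)]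
    push_cast
    rw [one_div_mul_cancel (by positivity), Real.rpow_one]
  obtain ⟨C, hC0, hC⟩ := exists_le_mul_pow_of_tendsto_ratio
    (Z := gegenbauerDecay lam (2 * (2 * N + 1))) (a := 1 / 4) (c := 1 / (4 * ψ ^ 2)) (by positivity)
    (by rw [one_div_lt_one_div (by norm_num) (by positivity)]
        nlinarith)
    (fun n hn => gegenbauerDecay_pos hlam hlam0 (2 * (2 * N + 1)) n hn)
    (tendsto_gegenbauerDecay_ratio hlam hlam0 _)
  have hW := gegenbauerNorm_pos hlam hlam0 0
  refine ⟨√(4 * C * gegenbauerNorm lam 0), ψ, by positivity, hψ0, hψ1, ?_⟩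
  intro M hM u hu hder l hl x hx
  have hh := gegenbauerNorm_pos hlam hlam0 l
  have hP := abs_gegenbauer_eval_le hN l hx
  have hI := sq_integral_mul_gegenbauer_le_of_iteratedDerivWithin hlam hlam0 hu
    (Nat.sub_le l (l / D)) (hder (l - l / D))
  have hQ := prod_le_quarter_pow_mul hlam hδ hD hl
  rw [prod_range_ratio_eq, prod_range_ratio_eq, Finset.prod_mul_distrib (s := .range l),
    prod_range_natCast_sub] at hQ
  have hZ := hC l hl
  -- The factor 4 compensates for rounding down in `l / D`.
  have hψl : (1 / 4 : ℝ) ^ (l / D) ≤ 4 * (ψ ^ 4) ^ l := by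
    have h1 : ψ ^ (4 * D * (l / D + 1)) ≤ ψ ^ (4 * l) := by
      apply pow_le_pow_of_le_one hψ0.le hψ1.le
      rw [mul_assoc]
      exact Nat.mul_le_mul_left 4 (Nat.lt_mul_div_succ l hDpos).le
    rw [pow_mul, hψD, pow_succ, pow_mul] at h1
    linarith
  have hprod := prod_natCast_add_pos hlam hl (m := l)
  have hZ0 := (gegenbauerDecay_pos hlam hlam0 (2 * (2 * N + 1)) l hl).le
  set m := l - l / D
  set Qm := ∏ j ∈ Finset.range m, (((l : ℝ) - j) * ((l : ℝ) + j + 2 * lam))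
  set P := ∏ j ∈ Finset.range l, ((l : ℝ) + j + 2 * lam) with hPdef
  set I := ∫ x in (-1 : ℝ)..1, u x * (gegenbauer lam l).eval x * (1 - x ^ 2) ^ (lam - 1 / 2)
  have hlf : (0 : ℝ) < l.factorial := by positivity
  apply abs_le_of_sq_le_sq _ (by positivity)
  have hsq : (gegenbauer lam l).eval x ^ 2 ≤ ((l : ℝ) + 1) ^ (2 * (2 * N + 1)) := by
    rw [← sq_abs, mul_comm 2 (2 * N + 1), pow_mul]
    exact pow_le_pow_left₀ (abs_nonneg _) hP 2
  set E := ((l : ℝ) + 1) ^ (2 * (2 * N + 1)) with hE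
  set h := gegenbauerNorm lam l with hhdef
  set W := gegenbauerNorm lam 0
  calc (gegenbauerCoeff lam u l * (gegenbauer lam l).eval x) ^ 2
      = (1 / h) ^ 2 * I ^ 2 * (gegenbauer lam l).eval x ^ 2 := by
        rw [gegenbauerCoeff]; ring
    _ ≤ (1 / h) ^ 2 * (h * ((M * (m.factorial : ℝ) / δ ^ m) ^ 2 * W) / Qm) * E := by
        have := (sq_nonneg I).trans hI
        gcongr
    _ = M ^ 2 * W * (1 / h) * E * (((m.factorial : ℝ) / δ ^ m) ^ 2 / Qm) := by
        field_simp
    _ ≤ M ^ 2 * W * (1 / h) * E * ((1 / 4) ^ (l / D) *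
          (((l.factorial : ℝ) / δ ^ l) ^ 2 / ((l.factorial : ℝ) * P))) := by
        have : 0 ≤ M ^ 2 * W * (1 / h) * E := by positivity
        gcongr
    _ = M ^ 2 * W * (1 / 4) ^ (l / D) * (1 / δ ^ l) ^ 2 *
          gegenbauerDecay lam (2 * (2 * N + 1)) l := by
        rw [gegenbauerDecay, ← hPdef, ← hE, ← hhdef]
        field_simp
    _ ≤ M ^ 2 * W * (4 * (ψ ^ 4) ^ l) * (1 / δ ^ l) ^ 2 * (C * (1 / (4 * ψ ^ 2)) ^ l) := by gcongr
    _ = (√(4 * C * W) * M * (ψ / (2 * δ)) ^ l) ^ 2 := by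
        rw [mul_pow, mul_pow, Real.sq_sqrt (by positivity)]
        have : (ψ ^ 4) ^ l * (1 / δ ^ l) ^ 2 * (1 / (4 * ψ ^ 2)) ^ l = ((ψ / (2 * δ)) ^ l) ^ 2 := by
          rw [← one_div_pow, pow_right_comm (1 / δ), ← mul_pow, ← mul_pow,
            pow_right_comm (ψ / (2 * δ))]
          congr 1
          field_simp
          norm_num
        rw [← this]
        ring

/-! ### Completeness and convergence of the expansion -/

/-- The recurrence, solved for x C_n, makes the span stable under multiplication by X; it contains
1, hence all monomials. -/
theorem span_range_gegenbauer {lam : ℝ} (hlam : -(1 / 2) < lam) (hlam0 : lam ≠ 0) :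
    Submodule.span ℝ (Set.range (gegenbauer lam)) = ⊤ := by
  set V := Submodule.span ℝ (Set.range (gegenbauer lam))
  have hmem : ∀ n, gegenbauer lam n ∈ V := fun n => Submodule.subset_span ⟨n, rfl⟩
  have hX : ∀ n, X * gegenbauer lam n ∈ V := by
    rintro (_ | n)
    · have : X * gegenbauer lam 0 = (2 * lam)⁻¹ • gegenbauer lam 1 := by
        refine Polynomial.funext fun x => ?_
        simp
        field_simp
      rw [this]
      exact V.smul_mem _ (hmem 1)
    · have hn : (0 : ℝ) ≤ n := n.cast_nonneg
      have h1 : (n : ℝ) + 1 + lam ≠ 0 := by linarith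
      have : X * gegenbauer lam (n + 1)
          = (((n : ℝ) + 2) / (2 * ((n : ℝ) + 1 + lam))) • gegenbauer lam (n + 2)
            + (((n : ℝ) + 2 * lam) / (2 * ((n : ℝ) + 1 + lam))) • gegenbauer lam n := by
        refine Polynomial.funext fun x => ?_
        have := gegenbauer_recurrence lam n x
        simp only [eval_mul, eval_X, eval_add, eval_smul, smul_eq_mul]
        field_simp
        linear_combination -this
      rw [this]
      exact V.add_mem (V.smul_mem _ (hmem _)) (V.smul_mem _ (hmem _))
  have hXV : ∀ p ∈ V, X * p ∈ V := by
    intro p hp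
    induction hp using Submodule.span_induction with
    | mem p hp => obtain ⟨n, rfl⟩ := hp; exact hX n
    | zero => simp
    | add p q _ _ h1 h2 => rw [mul_add]; exact V.add_mem h1 h2
    | smul a p _ h => rw [mul_smul_comm]; exact V.smul_mem _ h
  have hpow : ∀ n : ℕ, (X : ℝ[X]) ^ n ∈ V := by
    intro n
    induction n with
    | zero => simpa [gegenbauer] using hmem 0
    | succ n ih => rw [pow_succ']; exact hXV _ ih
  rw [eq_top_iff]
  intro p _
  induction p using Polynomial.induction_on' with
  | add p q h1 h2 => exact V.add_mem (h1 trivial) (h2 trivial)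
  | monomial n a =>
    rw [← C_mul_X_pow_eq_monomial, ← smul_eq_C_mul]
    exact V.smul_mem _ (hpow n)

/-- The Gegenbauer polynomials are complete among continuous functions on `[-1, 1]`. -/
theorem eqOn_zero_of_integral_mul_gegenbauer_eq_zero {lam : ℝ} (hlam : -(1 / 2) < lam)
    (hlam0 : lam ≠ 0) {g : ℝ → ℝ} (hg : ContinuousOn g (Set.Icc (-1) 1))
    (h : ∀ l, ∫ x in (-1 : ℝ)..1,
      g x * (gegenbauer lam l).eval x * (1 - x ^ 2) ^ (lam - 1 / 2) = 0) :
    Set.EqOn g 0 (Set.Icc (-1) 1) := by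
  have hint : ∀ p : ℝ[X], IntervalIntegrable
      (fun x => g x * p.eval x * (1 - x ^ 2) ^ (lam - 1 / 2)) MeasureTheory.volume (-1) 1 :=
    fun p => intervalIntegrable_mul_weight hlam (g := fun x => g x * p.eval x)
      (hg.mul p.continuousOn)
  have hpoly : ∀ p : ℝ[X], ∫ x in (-1 : ℝ)..1,
      g x * p.eval x * (1 - x ^ 2) ^ (lam - 1 / 2) = 0 := by
    intro p
    have hp : p ∈ Submodule.span ℝ (Set.range (gegenbauer lam)) := by
      rw [span_range_gegenbauer hlam hlam0]; trivial
    induction hp using Submodule.span_induction with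
    | mem p hp => obtain ⟨n, rfl⟩ := hp; exact h n
    | zero => simp
    | add p q _ _ h1 h2 =>
      simp only [eval_add, mul_add, add_mul]
      rw [intervalIntegral.integral_add (hint p) (hint q), h1, h2, add_zero]
    | smul a p _ h =>
      simp only [eval_smul, smul_eq_mul, mul_left_comm _ a, mul_assoc a]
      rw [intervalIntegral.integral_const_mul, h, mul_zero]
  have i1 := intervalIntegrable_mul_weight hlam (g := fun x => g x * g x) (hg.mul hg)
  have i2 := intervalIntegrable_mul_weight hlam (g := fun x => |g x|) hg.abs
  set J := ∫ x in (-1 : ℝ)..1, |g x| * (1 - x ^ 2) ^ (lam - 1 / 2)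
  have hJ : 0 ≤ J := intervalIntegral.integral_nonneg (by norm_num) fun x hx =>
    mul_nonneg (abs_nonneg _) (weight_nonneg hx)
  -- As g is orthogonal to all polynomials, g² may be replaced by g(g - p) with p a Weierstrass
  -- approximation.
  have hle : ∀ ε : ℝ, 0 < ε →
      ∫ x in (-1 : ℝ)..1, g x * g x * (1 - x ^ 2) ^ (lam - 1 / 2) ≤ ε * J := by
    intro ε hε
    obtain ⟨p, hp⟩ := exists_polynomial_near_of_continuousOn (-1) 1 g hg ε hε
    have : ∫ x in (-1 : ℝ)..1, g x * g x * (1 - x ^ 2) ^ (lam - 1 / 2)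
        = ∫ x in (-1 : ℝ)..1, (g x * g x * (1 - x ^ 2) ^ (lam - 1 / 2)
          - g x * p.eval x * (1 - x ^ 2) ^ (lam - 1 / 2)) := by
      rw [intervalIntegral.integral_sub i1 (hint p), hpoly p, sub_zero]
    rw [this, ← intervalIntegral.integral_const_mul]
    refine intervalIntegral.integral_mono_on (by norm_num) (i1.sub (hint p)) (i2.const_mul ε) ?_
    intro x hx
    rw [← sub_mul, ← mul_assoc]
    refine mul_le_mul_of_nonneg_right ?_ (weight_nonneg hx)
    calc g x * g x - g x * p.eval x ≤ |g x * g x - g x * p.eval x| := le_abs_self _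
      _ = |p.eval x - g x| * |g x| := by rw [← mul_sub, abs_mul, abs_sub_comm, mul_comm]
      _ ≤ ε * |g x| := by gcongr; exact (hp x hx).le
  have hnn : ∀ x ∈ Set.Icc (-1 : ℝ) 1, 0 ≤ g x * g x * (1 - x ^ 2) ^ (lam - 1 / 2) :=
    fun x hx => mul_nonneg (mul_self_nonneg _) (weight_nonneg hx)
  have hzero : ∫ x in (-1 : ℝ)..1, g x * g x * (1 - x ^ 2) ^ (lam - 1 / 2) = 0 := by
    refine le_antisymm (le_of_forall_pos_le_add fun ε hε => ?_)
      (intervalIntegral.integral_nonneg (by norm_num) hnn)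
    refine (hle (ε / (J + 1)) (by positivity)).trans ?_
    rw [zero_add, div_mul_eq_mul_div, div_le_iff₀ (by positivity)]
    nlinarith
  rw [intervalIntegral.integral_eq_zero_iff_of_le_of_nonneg_ae (by norm_num)
    (MeasureTheory.ae_restrict_of_forall_mem measurableSet_Ioc
      fun x hx => hnn x (Set.Ioc_subset_Icc_self hx)) i1,
    ← MeasureTheory.restrict_Ioo_eq_restrict_Ioc] at hzero
  refine MeasureTheory.Measure.eqOn_Icc_of_ae_eq (μ := MeasureTheory.volume) (by norm_num) ?_ hg
    continuousOn_const
  rw [← MeasureTheory.restrict_Ioo_eq_restrict_Icc]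
  filter_upwards [hzero, MeasureTheory.ae_restrict_mem measurableSet_Ioo] with x hx hx'
  have hw : (1 - x ^ 2) ^ (lam - 1 / 2) ≠ 0 :=
    (Real.rpow_pos_of_pos (by nlinarith [hx'.1, hx'.2]) _).ne'
  exact mul_self_eq_zero.1 ((mul_eq_zero.1 hx).resolve_right hw)

/-- The sum is continuous and, by dominated convergence and orthogonality, has the coefficients of
u; completeness applies to the difference. -/
theorem eqOn_tsum_gegenbauer {lam : ℝ} (hlam : -(1 / 2) < lam)
    (hlam0 : lam ≠ 0) {u : ℝ → ℝ} (hu : ContinuousOn u (Set.Icc (-1) 1)) {b : ℕ → ℝ}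
    (hb : Summable b)
    (h : ∀ l, ∀ x ∈ Set.Icc (-1 : ℝ) 1,
      |gegenbauerCoeff lam u l * (gegenbauer lam l).eval x| ≤ b l) :
    Set.EqOn u (fun x => ∑' l, gegenbauerCoeff lam u l * (gegenbauer lam l).eval x)
      (Set.Icc (-1) 1) := by
  set S : ℝ → ℝ := fun x => ∑' l, gegenbauerCoeff lam u l * (gegenbauer lam l).eval x with hS
  have hScont : ContinuousOn S (Set.Icc (-1) 1) :=
    continuousOn_tsum (fun l => (continuous_const.mul (gegenbauer lam l).continuous).continuousOn)
      hb h
  obtain ⟨N, hN⟩ := exists_nat_ge |lam|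
  have hcoef : ∀ k, ∫ x in (-1 : ℝ)..1,
      S x * (gegenbauer lam k).eval x * (1 - x ^ 2) ^ (lam - 1 / 2)
      = ∫ x in (-1 : ℝ)..1, u x * (gegenbauer lam k).eval x * (1 - x ^ 2) ^ (lam - 1 / 2) := by
    intro k
    set B := ((k : ℝ) + 1) ^ (2 * N + 1)
    have hsum := intervalIntegral.hasSum_integral_of_dominated_convergence
      (μ := MeasureTheory.volume) (a := -1) (b := 1)
      (F := fun l x => gegenbauerCoeff lam u l * (gegenbauer lam l).eval x *
        (gegenbauer lam k).eval x * (1 - x ^ 2) ^ (lam - 1 / 2))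
      (f := fun x => S x * (gegenbauer lam k).eval x * (1 - x ^ 2) ^ (lam - 1 / 2))
      (fun l x => b l * (B * (1 - x ^ 2) ^ (lam - 1 / 2))) ?_ ?_ ?_ ?_ ?_
    · have hterm : ∀ l, ∫ x in (-1 : ℝ)..1, gegenbauerCoeff lam u l * (gegenbauer lam l).eval x *
          (gegenbauer lam k).eval x * (1 - x ^ 2) ^ (lam - 1 / 2)
          = gegenbauerCoeff lam u l * ∫ x in (-1 : ℝ)..1, (gegenbauer lam l).eval x *
          (gegenbauer lam k).eval x * (1 - x ^ 2) ^ (lam - 1 / 2) := by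
        intro l
        rw [← intervalIntegral.integral_const_mul]
        simp only [mul_assoc]
      simp only [hterm] at hsum
      have hsingle := hasSum_single (f := fun l => gegenbauerCoeff lam u l *
        ∫ x in (-1 : ℝ)..1, (gegenbauer lam l).eval x * (gegenbauer lam k).eval x *
          (1 - x ^ 2) ^ (lam - 1 / 2)) k
        (fun l hl => by simp only [integral_gegenbauer_mul_of_ne hlam hlam0 hl, mul_zero])
      rw [hsum.unique hsingle, integral_gegenbauer_mul_self hlam hlam0, gegenbauerCoeff]
      have := (gegenbauerNorm_pos hlam hlam0 k).ne'
      generalize ∫ x in (-1 : ℝ)..1, u x * (gegenbauer lam k).eval x *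
        (1 - x ^ 2) ^ (lam - 1 / 2) = I
      field_simp
    · intro l
      have := intervalIntegrable_mul_weight hlam
        (g := fun x => gegenbauerCoeff lam u l * (gegenbauer lam l).eval x *
          (gegenbauer lam k).eval x) (by fun_prop)
      rw [intervalIntegrable_iff] at this
      exact this.1
    · intro l
      refine Filter.Eventually.of_forall fun x hx => ?_
      rw [Set.uIoc_of_le (by norm_num)] at hx
      have hx' := Set.Ioc_subset_Icc_self hx
      rw [norm_mul, norm_mul, Real.norm_of_nonneg (weight_nonneg hx'), mul_assoc]
      refine mul_le_mul (h l x hx') ?_ (mul_nonneg (norm_nonneg _) (weight_nonneg hx'))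
        ((abs_nonneg _).trans (h l x hx'))
      exact mul_le_mul_of_nonneg_right (abs_gegenbauer_eval_le hN k hx') (weight_nonneg hx')
    · exact Filter.Eventually.of_forall fun x _ => hb.mul_right _
    · simp only [tsum_mul_right]
      exact ((intervalIntegrable_one_sub_sq_rpow (by linarith)).const_mul _).const_mul _
    · refine Filter.Eventually.of_forall fun x hx => ?_
      rw [Set.uIoc_of_le (by norm_num)] at hx
      have hs : Summable fun l => gegenbauerCoeff lam u l * (gegenbauer lam l).eval x :=
        hb.of_norm_bounded fun l => h l x (Set.Ioc_subset_Icc_self hx)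
      exact (hs.hasSum.mul_right _).mul_right _
  have hzero := eqOn_zero_of_integral_mul_gegenbauer_eq_zero hlam hlam0 (hu.sub hScont) fun l => by
    have i1 := intervalIntegrable_mul_weight hlam
      (g := fun x => u x * (gegenbauer lam l).eval x) (hu.mul (gegenbauer lam l).continuousOn)
    have i2 := intervalIntegrable_mul_weight hlam
      (g := fun x => S x * (gegenbauer lam l).eval x) (hScont.mul (gegenbauer lam l).continuousOn)
    simp only [Pi.sub_apply, sub_mul]
    rw [intervalIntegral.integral_sub i1 i2, hcoef l, sub_self]
  intro x hx
  exact sub_eq_zero.1 (hzero hx)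

/-! ### The truncation error -/

theorem exists_pow_le_mul_rpow {ψ : ℝ} (hψ0 : 0 < ψ) (hψ1 : ψ < 1) (lam : ℝ) :
    ∃ K : ℝ, 0 < K ∧ ∀ n : ℕ, 1 ≤ n → ψ ^ n ≤ K * (n : ℝ) ^ lam := by
  obtain ⟨N, hN⟩ := exists_nat_ge |lam|
  obtain ⟨K, hK⟩ := (tendsto_pow_const_mul_const_pow_of_abs_lt_one N
    (by rwa [abs_of_pos hψ0] : |ψ| < 1)).bddAbove_range
  refine ⟨max K 1, by positivity, fun n hn => ?_⟩
  have hn' : (1 : ℝ) ≤ n := by exact_mod_cast hn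
  have h1 : (n : ℝ) ^ N * ψ ^ n ≤ K := hK ⟨n, rfl⟩
  have h2 : 1 ≤ (n : ℝ) ^ lam * (n : ℝ) ^ N := by
    rw [← Real.rpow_natCast, ← Real.rpow_add (by linarith)]
    exact Real.one_le_rpow hn' (by linarith [neg_abs_le lam])
  calc ψ ^ n = 1 * ψ ^ n := (one_mul _).symm
    _ ≤ ((n : ℝ) ^ lam * (n : ℝ) ^ N) * ψ ^ n := by gcongr
    _ = ((n : ℝ) ^ N * ψ ^ n) * (n : ℝ) ^ lam := by ring
    _ ≤ max K 1 * (n : ℝ) ^ lam := by gcongr; exact h1.trans (le_max_left _ _)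

theorem propositionA1 (δ : ℝ) (hδ : 1 ≤ δ) (lam : ℝ) (hlam : -(1 / 2) < lam) (hlam0 : lam ≠ 0) :
    ∃ K : ℝ, 0 < K ∧
      ∀ M : ℝ, 0 < M →
      ∀ u : ℝ → ℝ, AnalyticOn ℝ u (Set.Icc (-1) 1) →
        (∀ k : ℕ, ∀ x ∈ Set.Icc (-1 : ℝ) 1,
          |iteratedDerivWithin k u (Set.Icc (-1) 1) x| ≤ M * (k.factorial : ℝ) / δ ^ k) →
        ∀ n : ℕ, 1 ≤ n → ∀ x ∈ Set.Icc (-1 : ℝ) 1,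
          |gegenbauerProj lam n u x - u x| ≤ K * M * ((n : ℝ) ^ lam / (2 * δ) ^ n) := by
  obtain ⟨K, ψ, hK, hψ0, hψ1, hbound⟩ := exists_abs_gegenbauerCoeff_mul_le hδ hlam hlam0
  obtain ⟨K', hK', hpow⟩ := exists_pow_le_mul_rpow hψ0 hψ1 lam
  set r := ψ / (2 * δ) with hr
  have hr0 : 0 < r := by positivity
  have hr1 : r < 1 := (div_lt_one (by positivity)).2 (by linarith)
  refine ⟨K * K' / (1 - r), div_pos (by positivity) (by linarith), ?_⟩
  intro M hM u hu hder n hn x hx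
  have hcd : ContDiffOn ℝ ⊤ u (Set.Icc (-1) 1) := hu.contDiffOn (uniqueDiffOn_Icc (by norm_num))
  have hb := hbound M hM u hcd hder
  have hgeo := summable_geometric_of_lt_one hr0.le hr1
  set c0 := |gegenbauerCoeff lam u 0|
  -- The term l = 0 lies outside `hb`, so `c0` is added. This serves convergence only: the tail
  -- below starts at n + 1 and uses `hb`, so the final constant does not depend on u.
  have hb' : ∀ l, ∀ y ∈ Set.Icc (-1 : ℝ) 1,
      |gegenbauerCoeff lam u l * (gegenbauer lam l).eval y| ≤ (K * M + c0) * r ^ l := by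
    rintro (_ | l) y hy
    · simp only [gegenbauer_zero_eval, mul_one, pow_zero]
      exact le_add_of_nonneg_left (by positivity)
    · refine (hb (l + 1) (by omega) y hy).trans ?_
      gcongr
      exact le_add_of_nonneg_right (abs_nonneg _)
  have heq := eqOn_tsum_gegenbauer hlam hlam0 hcd.continuousOn (hgeo.mul_left _) hb' hx
  have hs : Summable fun l => gegenbauerCoeff lam u l * (gegenbauer lam l).eval x :=
    (hgeo.mul_left _).of_norm_bounded fun l => hb' l x hx
  have htail : |∑' l, gegenbauerCoeff lam u (l + (n + 1)) * (gegenbauer lam (l + (n + 1))).eval x|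
      ≤ K * M * r ^ n * (1 - r)⁻¹ := by
    rw [← Real.norm_eq_abs]
    refine tsum_of_norm_bounded ((hasSum_geometric_of_lt_one hr0.le hr1).mul_left (K * M * r ^ n)) ?_
    intro l
    refine (hb (l + (n + 1)) (by omega) x hx).trans ?_
    rw [mul_assoc (K * M), ← pow_add]
    refine mul_le_mul_of_nonneg_left ?_ (by positivity)
    exact pow_le_pow_of_le_one hr0.le hr1.le (by omega)
  have hdiff : gegenbauerProj lam n u x - u x
      = -∑' l, gegenbauerCoeff lam u (l + (n + 1)) * (gegenbauer lam (l + (n + 1))).eval x := by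
    rw [heq]
    simp only
    rw [← hs.sum_add_tsum_nat_add (n + 1), gegenbauerProj]
    ring
  rw [hdiff, abs_neg]
  refine htail.trans ?_
  rw [hr, div_pow]
  have h1r : 0 < 1 - r := by linarith
  calc K * M * (ψ ^ n / (2 * δ) ^ n) * (1 - r)⁻¹
      ≤ K * M * (K' * (n : ℝ) ^ lam / (2 * δ) ^ n) * (1 - r)⁻¹ := by
        have := hpow n hn
        gcongr
    _ = K * K' / (1 - r) * M * ((n : ℝ) ^ lam / (2 * δ) ^ n) := by ring
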